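/- Let $G$ be a compact second countable (Hausdorff, hence metrizable) topological group with normalized Haar measure $m$, let $\mu$ be a Borel probability measure on $G$, and let $\mu^{*n}$ be its $n$-fold convolution power. Call $\mu$ adapted if the smallest closed subgroup of $G$ containing $\operatorname{supp}(\mu)$ is $G$, and strictly aperiodic if $\operatorname{supp}(\mu)$ is not contained in any coset of any proper closed normal subgroup of $G$. Assume that $\mu$ is adapted. Then the weak-* limit $\lim_{n\to\infty}\mu^{*n}$ exists if and only if $\mu$ is strictly aperiodic, and whenever the limit exists it is equal to $m$. In particular, if $\mu$ is adapted and strictly aperiodic, then $\mu^{*n}\to m$ in the weak-* topology. Moreover, suppose that $\mu$ is adapted and strictly aperiodic, and let $d$ be a bi-invariant metric on $G$ inducing its topology. Then for every $\varepsilon>0$: (a) there is $n\ge 1$ such that $\operatorname{supp}(\mu^{*n})$ is $\varepsilon$-dense in $G$, that is, every point of $G$ is at distance less than $\varepsilon$ from some point of $\operatorname{supp}(\mu^{*n})$; (b) there is $n\ge 1$ such that $\mu^{*n}$ has no deterministic $\varepsilon$-images, that is, there are no closed sets $A,B\subset G$ such that each of $A$, $B$, $A^{c}$, $B^{c}$ contains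 an open ball of radius $\varepsilon$ and $gA=B$ for all $g\in\operatorname{supp}(\mu^{*n})$. -/

import Mathlib

open MeasureTheory Filter Topology

namespace RandomWalk

/-- The normalized Haar measure of a compact group, as a probability measure. -/
noncomputable def haarProb (G : Type*) [Group G] [TopologicalSpace G] [IsTopologicalGroup G]
    [CompactSpace G] [MeasurableSpace G] [BorelSpace G] : ProbabilityMeasure G :=
  ⟨Measure.haarMeasure (⊤ : TopologicalSpace.PositiveCompacts G), ⟨by
    simpa using Measure.haarMeasure_self (K₀ := (⊤ : TopologicalSpace.PositiveCompacts G))⟩⟩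

/-- The convolution power `μ^{*n}`: the law of a product of `n` independent `μ`-distributed
elements, with `μ^{*0}` the unit mass at the identity. -/
noncomputable def convPow {G : Type*} [Group G] [MeasurableSpace G] [MeasurableMul₂ G]
    (μ : ProbabilityMeasure G) : ℕ → ProbabilityMeasure G
  | 0 => ⟨Measure.dirac 1, inferInstance⟩
  | n + 1 => ⟨Measure.mconv (μ : Measure G) (convPow μ n : Measure G), inferInstance⟩

/-- The topological support of a Borel probability measure. -/
def supp {G : Type*} [TopologicalSpace G] [MeasurableSpace G] (μ : ProbabilityMeasure G) : Set G :=
  (μ : Measure G).support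

/-- `μ` is adapted: the smallest closed subgroup containing its support is the whole group. -/
def IsAdapted {G : Type*} [Group G] [TopologicalSpace G] [MeasurableSpace G]
    (μ : ProbabilityMeasure G) : Prop :=
  ∀ H : Subgroup G, IsClosed (H : Set G) → supp μ ⊆ (H : Set G) → H = ⊤

/-- `μ` is strictly aperiodic: its support is not contained in any coset of any proper closed
normal subgroup (left and right cosets of a normal subgroup agree). -/
def IsStrictlyAperiodic {G : Type*} [Group G] [TopologicalSpace G] [MeasurableSpace G]
    (μ : ProbabilityMeasure G) : Prop :=
  ∀ N : Subgroup G, N.Normal → IsClosed (N : Set G) → N ≠ ⊤ →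
    ∀ g : G, ¬ supp μ ⊆ (fun x => g * x) '' (N : Set G)

/-- `d` is a bi-invariant metric that induces the given topology of the group. -/
structure IsBiinvariant {G : Type*} [Group G] [tG : TopologicalSpace G] (d : MetricSpace G) :
    Prop where
  topology_eq : d.toPseudoMetricSpace.toUniformSpace.toTopologicalSpace = tG
  left_inv : ∀ g x y : G, d.dist (g * x) (g * y) = d.dist x y
  right_inv : ∀ g x y : G, d.dist (x * g) (y * g) = d.dist x y

/-- `S` is `ε`-dense: every point of the space is at distance less than `ε` from a point
of `S`. -/
def IsEpsDense {G : Type*} (d : MetricSpace G) (ε : ℝ) (S : Set G) : Prop :=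
  ∀ x : G, ∃ y ∈ S, d.dist x y < ε

/-- `S` contains an open ball of radius `ε`. -/
def ContainsBall {G : Type*} (d : MetricSpace G) (ε : ℝ) (S : Set G) : Prop :=
  ∃ x : G, {y | d.dist y x < ε} ⊆ S

/-- The "no deterministic `ε`-images" condition, for `G` acting on itself by left shifts. -/
def NoDeterministicEpsImages {G : Type*} [Group G] [TopologicalSpace G] [MeasurableSpace G]
    (d : MetricSpace G) (ε : ℝ) (μ : ProbabilityMeasure G) : Prop :=
  ¬ ∃ A B : Set G, IsClosed A ∧ IsClosed B ∧
    ContainsBall d ε A ∧ ContainsBall d ε B ∧ ContainsBall d ε Aᶜ ∧ ContainsBall d ε Bᶜ ∧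
    ∀ g ∈ supp μ, (fun x => g * x) '' A = B

end RandomWalk

namespace RandomWalk

/-! Let `S n` be the support of `μ^{*n}`. Along an idempotent ultrafilter `p`, the limits of `S n`
form a closed subsemigroup of a compact group, hence a subgroup `A`. The limits `B` of `S (n - 1)`
satisfy `S 1 * B ⊆ A` and `B * S 1 ⊆ A`; thus `S 1` normalizes `A` and lies in one coset of it.
Adaptedness makes `A` normal, strict aperiodicity makes it `G`, and some `S n` meets any finite
family of open sets (`exists_forall_inter_nonempty`).

So some power gives uniformly positive mass to all translates of a neighbourhood of `1`. Averaging
then contracts oscillations (`average_sub_average_le`), and averages of `f` tend uniformly to its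
Haar mean.

Conversely, a limit is `μ`-stationary, hence Haar by the maximum principle; mass confined to cosets
`g ^ n N` cannot converge to Haar measure. -/

open scoped Pointwise

/-! ### Limits of graded semigroups along an idempotent ultrafilter -/

section Semigroups

variable {G : Type*} [TopologicalSpace G]

/-- The limits along the ultrafilter `p` of points of the sets `S (φ n)`. -/
def limitSet (p : Ultrafilter ℕ+) (S : ℕ → Set G) (φ : ℕ+ → ℕ) : Set G :=
  {x | ∀ U ∈ 𝓝 x, ∀ᶠ n in (p : Filter ℕ+), (S (φ n) ∩ U).Nonempty}

theorem isClosed_limitSet (p : Ultrafilter ℕ+) (S : ℕ → Set G) (φ : ℕ+ → ℕ) :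
    IsClosed (limitSet p S φ) := by
  rw [← isOpen_compl_iff, isOpen_iff_mem_nhds]
  intro x hx
  simp only [limitSet, Set.mem_compl_iff, Set.mem_ofPred_eq, not_forall] at hx
  obtain ⟨U, hU, hn⟩ := hx
  filter_upwards [eventually_mem_nhds_iff.2 hU] with y hy h
  exact hn (h U hy)

theorem nonempty_limitSet [CompactSpace G] (p : Ultrafilter ℕ+) {S : ℕ → Set G} (φ : ℕ+ → ℕ)
    (hS : ∀ n, (S n).Nonempty) : (limitSet p S φ).Nonempty := by
  choose s hs using hS
  obtain ⟨x, -, hx⟩ := isCompact_univ.ultrafilter_le_nhds (p.map fun n => s (φ n)) (by simp)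
  refine ⟨x, fun U hU => ?_⟩
  have h : ∀ᶠ n in (p : Filter ℕ+), s (φ n) ∈ U := hx hU
  exact h.mono fun n hn => ⟨_, hs _, hn⟩

/-- Ellis's lemma in the compact semigroup of ultrafilters, with `p + p = p` unfolded into iterated
quantifiers. -/
theorem exists_idempotent_ultrafilter :
    ∃ p : Ultrafilter ℕ+, ∀ P : ℕ+ → Prop, (∀ᶠ n in (p : Filter ℕ+), P n) ↔
      ∀ᶠ m in (p : Filter ℕ+), ∀ᶠ n in (p : Filter ℕ+), P (m + n) := by
  let _ := Ultrafilter.addSemigroup (M := ℕ+)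
  obtain ⟨p, hp⟩ := exists_idempotent_of_compact_t2_of_continuous_add_left
    (M := Ultrafilter ℕ+) Ultrafilter.continuous_add_left
  refine ⟨p, fun P => ?_⟩
  conv_lhs => rw [← hp]
  exact Ultrafilter.eventually_add p p P

variable [Group G]

/-- Idempotence splits a `p`-typical index into two `p`-typical summands. Separate index maps let a
shift by one sit in either factor. -/
theorem mul_mem_limitSet [ContinuousMul G] {p : Ultrafilter ℕ+}
    (hp : ∀ P : ℕ+ → Prop, (∀ᶠ n in (p : Filter ℕ+), P n) ↔
      ∀ᶠ m in (p : Filter ℕ+), ∀ᶠ n in (p : Filter ℕ+), P (m + n))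
    {S : ℕ → Set G} (hmul : ∀ m n, ∀ x ∈ S m, ∀ y ∈ S n, x * y ∈ S (m + n))
    {φ ψ χ : ℕ+ → ℕ} (hφ : ∀ m n, φ m + ψ n = χ (m + n)) {x y : G}
    (hx : x ∈ limitSet p S φ) (hy : y ∈ limitSet p S ψ) : x * y ∈ limitSet p S χ := by
  intro U hU
  obtain ⟨V, hV, W, hW, hVW⟩ := mem_nhds_prod_iff.1 (continuous_mul.tendsto (x, y) hU)
  refine (hp _).2 ((hx V hV).mono fun m hm => (hy W hW).mono fun n hn => ?_)
  obtain ⟨a, ha, haV⟩ := hm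
  obtain ⟨b, hb, hbW⟩ := hn
  exact ⟨a * b, hφ m n ▸ hmul _ _ a ha b hb, hVW (Set.mk_mem_prod haV hbW)⟩

theorem mul_left_mem_limitSet [ContinuousMul G] {p : Ultrafilter ℕ+}
    {S : ℕ → Set G} (hmul : ∀ m n, ∀ x ∈ S m, ∀ y ∈ S n, x * y ∈ S (m + n))
    {φ ψ : ℕ+ → ℕ} {k : ℕ} (hφ : ∀ n, k + φ n = ψ n) {s x : G} (hs : s ∈ S k)
    (hx : x ∈ limitSet p S φ) : s * x ∈ limitSet p S ψ := by
  intro U hU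
  refine (hx _ ((continuous_const_mul s).tendsto x hU)).mono fun n hn => ?_
  obtain ⟨a, ha, haU⟩ := hn
  exact ⟨s * a, hφ n ▸ hmul _ _ s hs a ha, haU⟩

theorem mul_right_mem_limitSet [ContinuousMul G] {p : Ultrafilter ℕ+}
    {S : ℕ → Set G} (hmul : ∀ m n, ∀ x ∈ S m, ∀ y ∈ S n, x * y ∈ S (m + n))
    {φ ψ : ℕ+ → ℕ} {k : ℕ} (hφ : ∀ n, φ n + k = ψ n) {s x : G} (hs : s ∈ S k)
    (hx : x ∈ limitSet p S φ) : x * s ∈ limitSet p S ψ := by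
  intro U hU
  refine (hx _ ((continuous_mul_const s).tendsto x hU)).mono fun n hn => ?_
  obtain ⟨a, ha, haU⟩ := hn
  exact ⟨a * s, hφ n ▸ hmul _ _ a ha s hs, haU⟩

variable [IsTopologicalGroup G] [CompactSpace G]

/-- The integer powers of an element lie in every closed set containing its positive powers. -/
theorem zpow_mem_of_isClosed {T : Set G} (hT : IsClosed T)
    (hmul : ∀ x ∈ T, ∀ y ∈ T, x * y ∈ T) {x : G} (hx : x ∈ T) (m : ℤ) : x ^ m ∈ T := by
  have hpow : ∀ n : ℕ, x ^ (n + 1) ∈ T := fun n => by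
    induction n with
    | zero => simpa using hx
    | succ n ih => rw [pow_succ]; exact hmul _ ih _ hx
  -- By compactness, positive powers recur near every integer power.
  have h : MapClusterPt (x ^ m) atTop (x ^ · : ℕ → G) := mapClusterPt_self_zpow_atTop_pow x m
  refine isClosed_iff_frequently.1 hT _ (frequently_iff.2 fun {U} hU => ?_)
  obtain ⟨n, hn, hnU⟩ := (mapClusterPt_iff_frequently.1 h U hU).forall_exists_of_atTop 1
  refine ⟨_, hnU, ?_⟩
  obtain ⟨k, rfl⟩ := Nat.exists_eq_add_of_le' hn
  exact hpow k

/-- A nonempty closed subsemigroup of a compact group, as a subgroup. -/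
def closedSubgroup (T : Set G) (hT : IsClosed T) (hne : T.Nonempty)
    (hmul : ∀ x ∈ T, ∀ y ∈ T, x * y ∈ T) : Subgroup G where
  carrier := T
  mul_mem' hx hy := hmul _ hx _ hy
  one_mem' := by
    obtain ⟨x, hx⟩ := hne
    simpa using zpow_mem_of_isClosed hT hmul hx 0
  inv_mem' hx := by simpa using zpow_mem_of_isClosed hT hmul hx (-1)

/-- If the sets `S n` are graded-multiplicative and `S 1` is adapted and strictly aperiodic, then
finitely many nonempty open sets are met simultaneously by some `S n`. -/
theorem exists_forall_inter_nonempty {S : ℕ → Set G} (hne : ∀ n, (S n).Nonempty)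
    (hmul : ∀ m n, ∀ x ∈ S m, ∀ y ∈ S n, x * y ∈ S (m + n))
    (hgen : ∀ H : Subgroup G, IsClosed (H : Set G) → S 1 ⊆ (H : Set G) → H = ⊤)
    (haper : ∀ N : Subgroup G, N.Normal → IsClosed (N : Set G) → N ≠ ⊤ →
      ∀ g : G, ¬ S 1 ⊆ (fun x => g * x) '' (N : Set G))
    {ι : Type*} [Finite ι] {U : ι → Set G} (hU : ∀ i, IsOpen (U i))
    (hUne : ∀ i, (U i).Nonempty) : ∃ n, 1 ≤ n ∧ ∀ i, (S n ∩ U i).Nonempty := by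
  obtain ⟨p, hp⟩ := exists_idempotent_ultrafilter
  let A := limitSet p S (fun n => (n : ℕ))
  let B := limitSet p S PNat.natPred
  have hpred : ∀ n : ℕ+, PNat.natPred n + 1 = n := PNat.natPred_add_one
  have hAA : ∀ x ∈ A, ∀ y ∈ A, x * y ∈ A := fun x hx y hy =>
    mul_mem_limitSet hp hmul (fun m n => by simp) hx hy
  have hAB : ∀ x ∈ A, ∀ y ∈ B, x * y ∈ B := fun x hx y hy =>
    mul_mem_limitSet hp hmul (fun m n => by
      have := hpred n; have := hpred (m + n); rw [PNat.add_coe] at this; omega) hx hy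
  have hBA : ∀ x ∈ B, ∀ y ∈ A, x * y ∈ B := fun x hx y hy =>
    mul_mem_limitSet hp hmul (fun m n => by
      have := hpred m; have := hpred (m + n); rw [PNat.add_coe] at this; omega) hx hy
  have hSB : ∀ s ∈ S 1, ∀ y ∈ B, s * y ∈ A := fun s hs y hy =>
    mul_left_mem_limitSet hmul (fun n => by rw [add_comm]; exact hpred n) hs hy
  have hBS : ∀ y ∈ B, ∀ s ∈ S 1, y * s ∈ A := fun y hy s hs =>
    mul_right_mem_limitSet hmul hpred hs hy
  let N := closedSubgroup A (isClosed_limitSet _ _ _) (nonempty_limitSet _ _ hne) hAA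
  obtain ⟨y, hy⟩ : B.Nonempty := nonempty_limitSet _ _ hne
  obtain ⟨s, hs⟩ := hne 1
  -- The normalizer of `N`; both conjugations are required so that inverses are immediate.
  let H : Subgroup G :=
    { carrier := {g | ∀ a ∈ N, g * a * g⁻¹ ∈ N ∧ g⁻¹ * a * g ∈ N}
      one_mem' := by simp
      mul_mem' := fun {g h} hg hh a ha => by
        have h1 := (hg _ (hh a ha).1).1
        have h2 := (hh _ (hg a ha).2).2
        exact ⟨by simpa [mul_assoc] using h1, by simpa [mul_assoc] using h2⟩
      inv_mem' := fun {g} hg a ha => by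
        simpa using (hg a ha).symm }
  have hNc : IsClosed (N : Set G) := isClosed_limitSet _ _ _
  have hHc : IsClosed (H : Set G) := by
    have : (H : Set G) = ⋂ a ∈ N, {g | g * a * g⁻¹ ∈ N} ∩ {g | g⁻¹ * a * g ∈ N} := by
      ext g; simp [H]
    rw [this]
    exact isClosed_biInter fun a _ =>
      (hNc.preimage (by fun_prop : Continuous fun g : G => g * a * g⁻¹)).inter
        (hNc.preimage (by fun_prop : Continuous fun g : G => g⁻¹ * a * g))
  have hH : H = ⊤ := by
    -- `s a s⁻¹ = (s a y)(s y)⁻¹` and `s⁻¹ a s = (y s)⁻¹(y a s)`, with all factors in `A`.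
    refine hgen H hHc fun s hs a ha => ⟨?_, ?_⟩
    · have h1 : s * (a * y) ∈ N := hSB s hs _ (hAB a ha y hy)
      have h2 : s * y ∈ N := hSB s hs y hy
      simpa [mul_assoc] using N.mul_mem h1 (N.inv_mem h2)
    · have h1 : y * a * s ∈ N := hBS _ (hBA y hy a ha) s hs
      have h2 : y * s ∈ N := hBS y hy s hs
      simpa [mul_assoc] using N.mul_mem (N.inv_mem h2) h1
  have hNn : N.Normal := ⟨fun a ha g => by
    have hg : g ∈ H := hH ▸ Subgroup.mem_top g
    exact (hg a ha).1⟩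
  have hN : N = ⊤ := by
    by_contra hN
    -- `s⁻¹ t = (y s)⁻¹(y t)` puts `S 1` inside `s N`.
    refine haper N hNn hNc hN s fun t ht => ⟨s⁻¹ * t, ?_, by simp⟩
    have h1 : y * s ∈ N := hBS y hy s hs
    have h2 : y * t ∈ N := hBS y hy t ht
    simpa [mul_assoc] using N.mul_mem (N.inv_mem h1) h2
  have hev : ∀ᶠ n : ℕ+ in (p : Filter ℕ+), ∀ i, (S (n : ℕ) ∩ U i).Nonempty := by
    refine eventually_all.2 fun i => ?_
    obtain ⟨x, hx⟩ := hUne i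
    have hxA : x ∈ N := hN ▸ Subgroup.mem_top x
    exact hxA (U i) ((hU i).mem_nhds hx)
  obtain ⟨n, hn⟩ := hev.exists
  exact ⟨n, n.pos, hn⟩

end Semigroups
-- Uniform continuity by compactness. The two-sided form is inherited by averages of `f` with the
-- same `U` and `δ`.
theorem exists_nhds_one_forall_le {G : Type*} [Group G] [TopologicalSpace G]
    [IsTopologicalGroup G] [CompactSpace G] {f : G → ℝ} (hf : Continuous f) {δ : ℝ} (hδ : 0 < δ) :
    ∃ U : Set G, IsOpen U ∧ 1 ∈ U ∧ ∀ a b, ∀ u ∈ U, f (a * u * b) ≤ f (a * b) + δ := by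
  have h : ∀ᶠ u in 𝓝 (1 : G), ∀ p ∈ (Set.univ : Set (G × G)),
      f (p.1 * u * p.2) < f (p.1 * p.2) + δ := by
    refine isCompact_univ.eventually_forall_of_forall_eventually fun p _ => ?_
    exact ContinuousAt.eventually_lt (f := fun q : G × G × G => f (q.2.1 * q.1 * q.2.2))
      (g := fun q => f (q.2.1 * q.2.2) + δ) (Continuous.continuousAt (by fun_prop))
      (Continuous.continuousAt (by fun_prop)) (by simpa using hδ)
  obtain ⟨U, hU, hUo, h1⟩ := eventually_nhds_iff.1 h
  exact ⟨U, hUo, h1, fun a b u hu => (hU u hu (a, b) trivial).le⟩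

theorem nonempty_supp {G : Type*} [TopologicalSpace G] [SecondCountableTopology G]
    [MeasurableSpace G] (μ : ProbabilityMeasure G) : (supp μ).Nonempty :=
  Measure.nonempty_support (IsProbabilityMeasure.ne_zero (μ : Measure G))

/-! ### Convolution powers and averaging operators -/

section Convolution

variable {G : Type*} [Group G] [TopologicalSpace G] [IsTopologicalGroup G]
  [SecondCountableTopology G] [MeasurableSpace G] [BorelSpace G]

theorem convPow_succ (μ : ProbabilityMeasure G) (n : ℕ) :
    (convPow μ (n + 1) : Measure G) = Measure.mconv (μ : Measure G) (convPow μ n : Measure G) :=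
  rfl

theorem convPow_one (μ : ProbabilityMeasure G) : convPow μ 1 = μ :=
  Subtype.ext (Measure.mconv_dirac_one (μ : Measure G))

theorem convPow_add (μ : ProbabilityMeasure G) (m n : ℕ) :
    (convPow μ (m + n) : Measure G) =
      Measure.mconv (convPow μ m : Measure G) (convPow μ n : Measure G) := by
  induction m with
  | zero =>
    rw [zero_add]
    exact (Measure.dirac_one_mconv _).symm
  | succ m ih =>
    rw [Nat.succ_add, Nat.succ_eq_add_one, convPow_succ, convPow_succ, ih, Measure.mconv_assoc]

theorem mul_mem_support_mconv {μ ν : Measure G} [SFinite μ] [SFinite ν] {x y : G}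
    (hx : x ∈ μ.support) (hy : y ∈ ν.support) : x * y ∈ (Measure.mconv μ ν).support := by
  rw [Measure.mem_support_iff_forall] at *
  intro U hU
  obtain ⟨V, hV, W, hW, hVW⟩ := mem_nhds_prod_iff.1 (continuous_mul.tendsto (x, y) hU)
  calc 0 < μ V * ν W := ENNReal.mul_pos (hx V hV).ne' (hy W hW).ne'
    _ = (μ.prod ν) (V ×ˢ W) := (Measure.prod_prod V W).symm
    _ ≤ (μ.prod ν) ((fun p : G × G => p.1 * p.2) ⁻¹' U) := measure_mono hVW
    _ ≤ _ := Measure.le_map_apply measurable_mul.aemeasurable U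

theorem mul_mem_supp_convPow (μ : ProbabilityMeasure G) (m n : ℕ) :
    ∀ x ∈ supp (convPow μ m), ∀ y ∈ supp (convPow μ n), x * y ∈ supp (convPow μ (m + n)) := by
  intro x hx y hy
  unfold supp
  rw [convPow_add]
  exact mul_mem_support_mconv hx hy

/-- Normality gives `gN · gⁿN = gⁿ⁺¹N`. -/
theorem ae_mem_coset {μ : ProbabilityMeasure G} {N : Subgroup G} (hNn : N.Normal)
    (hNc : IsClosed (N : Set G)) {g : G} (hμ : supp μ ⊆ (fun x => g * x) '' (N : Set G)) (n : ℕ) :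
    ∀ᵐ x ∂(convPow μ n : Measure G), (g ^ n)⁻¹ * x ∈ N := by
  have hmeas : ∀ a : G, MeasurableSet {x | a * x ∈ N} := fun a =>
    (hNc.preimage (continuous_const_mul a)).measurableSet
  induction n with
  | zero =>
    refine (ae_dirac_iff (a := (1 : G)) (hmeas _)).2 ?_
    simp
  | succ n ih =>
    rw [convPow_succ, Measure.mconv, ae_map_iff measurable_mul.aemeasurable (hmeas _)]
    have h1 : ∀ᵐ x ∂(μ : Measure G), x ∈ (μ : Measure G).support := Measure.support_mem_ae
    filter_upwards [Measure.quasiMeasurePreserving_fst.ae h1,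
      Measure.quasiMeasurePreserving_snd.ae ih] with z hz1 hz2
    obtain ⟨a, ha, haz⟩ := hμ hz1
    rw [← haz]
    have h := N.mul_mem (hNn.conj_mem a ha (g ^ n)⁻¹) hz2
    convert h using 1
    rw [pow_succ']
    group

variable [CompactSpace G]

theorem integrable_of_continuous {X : Type*} [TopologicalSpace X] [CompactSpace X]
    [MeasurableSpace X] [OpensMeasurableSpace X] {f : X → ℝ} (hf : Continuous f)
    (μ : Measure X) [IsFiniteMeasure μ] : Integrable f μ :=
  hf.integrable_of_hasCompactSupport (HasCompactSupport.of_compactSpace f)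

/-- The average of the translates of `f` by the elements of `G`, weighted by `ν`. -/
noncomputable def average (ν : Measure G) (f : G → ℝ) (x : G) : ℝ := ∫ g, f (g * x) ∂ν

theorem integral_mconv (μ ν : Measure G) [IsFiniteMeasure μ] [IsFiniteMeasure ν] {f : G → ℝ}
    (hf : Continuous f) :
    ∫ z, f z ∂(Measure.mconv μ ν) = ∫ x, ∫ y, f (x * y) ∂ν ∂μ := by
  rw [Measure.mconv, integral_map measurable_mul.aemeasurable hf.aestronglyMeasurable]
  exact integral_prod _ (integrable_of_continuous (by fun_prop) _)

theorem integral_mconv_symm (μ ν : Measure G) [IsFiniteMeasure μ] [IsFiniteMeasure ν] {f : G → ℝ}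
    (hf : Continuous f) : ∫ z, f z ∂(Measure.mconv μ ν) = ∫ y, average μ f y ∂ν := by
  rw [integral_mconv μ ν hf]
  exact integral_integral_swap (integrable_of_continuous (by fun_prop) _)

theorem integral_average (ν m : Measure G) [IsProbabilityMeasure ν] [IsFiniteMeasure m]
    [m.IsMulLeftInvariant] {f : G → ℝ} (hf : Continuous f) :
    ∫ x, average ν f x ∂m = ∫ x, f x ∂m := by
  rw [← integral_mconv_symm ν m hf, integral_mconv ν m hf]
  simp [integral_mul_left_eq_self]

theorem continuous_average [T2Space G] (ν : Measure G) [IsFiniteMeasure ν] {f : G → ℝ} (hf : Continuous f) :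
    Continuous (average ν f) := by
  have := continuous_parametric_integral_of_continuous (μ := ν) (f := fun x g : G => f (g * x))
    (by unfold Function.uncurry; fun_prop) isCompact_univ
  simpa only [Measure.restrict_univ] using! this

theorem average_mconv (μ ν : Measure G) [IsFiniteMeasure μ] [IsFiniteMeasure ν] {f : G → ℝ}
    (hf : Continuous f) : average (Measure.mconv μ ν) f = average ν (average μ f) := by
  ext x
  refine (integral_mconv_symm μ ν (f := fun g => f (g * x)) (by fun_prop)).trans ?_
  simp only [average, mul_assoc]

/-- A point where `f` is small pulls down the averages of `f`: if translates of the set `U` have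
mass at least `β`, averaging contracts the part of the oscillation of `f` exceeding `δ`. -/
theorem average_sub_average_le (ν : Measure G) [IsProbabilityMeasure ν] {f : G → ℝ}
    (hf : Continuous f) {U : Set G} (hU : IsOpen U) {δ β C : ℝ} (hC : 0 ≤ C)
    (hfU : ∀ a b, ∀ u ∈ U, f (a * u * b) ≤ f (a * b) + δ)
    (hβ : ∀ z : G, β ≤ ν.real {g | z * g ∈ U}) (hosc : ∀ x y, f x - f y ≤ δ + C) (x y : G) :
    average ν f x - average ν f y ≤ δ + (1 - β) * C := by
  obtain ⟨z, -, hz⟩ := isCompact_univ.exists_isMinOn ⟨(1 : G), Set.mem_univ _⟩ hf.continuousOn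
  replace hz : ∀ w, f z ≤ f w := fun w => hz (Set.mem_univ w)
  have hy : f z ≤ average ν f y := by
    have := integral_mono (μ := ν) (integrable_const (f z))
      (integrable_of_continuous (f := fun g => f (g * y)) (by fun_prop) ν) fun g => hz _
    simpa using! this
  -- For `g ∈ E`, `g x` is the minimum point `z` with an element of `U` inserted, so `f (g x) ≤ f z
  -- + δ`; elsewhere the bound is `f z + δ + C`.
  let E : Set G := {g | x * z⁻¹ * g ∈ U}
  have hE : MeasurableSet E := (hU.preimage (continuous_const_mul _)).measurableSet
  have hx : average ν f x ≤ (f z + δ + C) - ν.real E * C := by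
    have h1 : Integrable (E.indicator fun _ => C) ν := (integrable_const C).indicator hE
    have := integral_mono (μ := ν) (f := fun g => f (g * x))
      (integrable_of_continuous (by fun_prop) ν)
      ((integrable_const (f z + δ + C)).sub h1) fun g => by
        by_cases hg : g ∈ E
        · have h2 := hfU (z * x⁻¹) x _ hg
          simp only [Pi.sub_apply, Set.indicator_of_mem hg]
          have e1 : z * x⁻¹ * (x * z⁻¹ * g) * x = g * x := by group
          have e2 : z * x⁻¹ * x = z := by group
          rw [e1, e2] at h2
          linarith
        · simp only [Pi.sub_apply, Set.indicator_of_notMem hg]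
          linarith [hosc (g * x) z]
    simp only [Pi.sub_apply] at this
    rw [integral_sub (integrable_const _) h1, integral_indicator_const _ hE] at this
    simpa using! this
  have := mul_le_mul_of_nonneg_right (hβ (x * z⁻¹)) hC
  linarith

theorem average_le_average_add (ν : Measure G) [IsProbabilityMeasure ν] {f : G → ℝ}
    (hf : Continuous f) {U : Set G} {δ : ℝ}
    (hfU : ∀ a b, ∀ u ∈ U, f (a * u * b) ≤ f (a * b) + δ) :
    ∀ a b, ∀ u ∈ U, average ν f (a * u * b) ≤ average ν f (a * b) + δ := by
  intro a b u hu
  have h1 : Integrable (fun g => f (g * (a * b))) ν := integrable_of_continuous (by fun_prop) ν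
  have := integral_mono (μ := ν) (f := fun g => f (g * (a * u * b)))
    (integrable_of_continuous (by fun_prop) ν) (h1.add (integrable_const δ)) fun g => by
      simpa [mul_assoc] using hfU (g * a) b u hu
  simp only [Pi.add_apply] at this
  rw [integral_add h1 (integrable_const δ)] at this
  simpa using! this

variable [T2Space G]

/-! ### Convergence to Haar measure -/

theorem exists_forall_supp_inter_nonempty {μ : ProbabilityMeasure G} (hμ : IsAdapted μ)
    (hap : IsStrictlyAperiodic μ) {ι : Type*} [Finite ι] {U : ι → Set G}
    (hU : ∀ i, IsOpen (U i)) (hUne : ∀ i, (U i).Nonempty) :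
    ∃ n, 1 ≤ n ∧ ∀ i, (supp (convPow μ n) ∩ U i).Nonempty :=
  exists_forall_inter_nonempty (S := fun n => supp (convPow μ n)) (fun n => nonempty_supp _)
    (mul_mem_supp_convPow μ) (by rw [convPow_one]; exact hμ)
    (by rw [convPow_one]; exact hap) hU hUne

/-- Some convolution power gives mass bounded below to all translates of a given neighbourhood
of the identity. -/
theorem exists_forall_le_real {μ : ProbabilityMeasure G} (hμ : IsAdapted μ)
    (hap : IsStrictlyAperiodic μ) {U : Set G} (hU : U ∈ 𝓝 1) :
    ∃ k, ∃ β : ℝ, 0 < β ∧ ∀ z : G, β ≤ (convPow μ k : Measure G).real {g | z * g ∈ U} := by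
  have hc : Tendsto (fun p : G × G => p.1⁻¹ * p.2) (𝓝 (1, 1)) (𝓝 1) :=
    (by fun_prop : Continuous fun p : G × G => p.1⁻¹ * p.2).tendsto' _ _ (by simp)
  -- With `V⁻¹V ⊆ U`, any `wV` containing `z⁻¹` lies in `z⁻¹U`; finitely many centres `w` suffice,
  -- and `β` is their least mass.
  obtain ⟨V, hVo, h1, hV⟩ : ∃ V : Set G, IsOpen V ∧ 1 ∈ V ∧ ∀ v ∈ V, ∀ w ∈ V, v⁻¹ * w ∈ U := by
    have h := hc hU
    rw [mem_map, nhds_prod_eq, mem_prod_same_iff] at h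
    obtain ⟨V', hV', hVU⟩ := h
    obtain ⟨V, hVV', hVo, h1⟩ := mem_nhds_iff.1 hV'
    exact ⟨V, hVo, h1, fun v hv w hw => hVU (Set.mk_mem_prod (hVV' hv) (hVV' hw))⟩
  have hop : ∀ w : G, IsOpen {g | w⁻¹ * g ∈ V} := fun w => hVo.preimage (continuous_const_mul _)
  have hmem : ∀ w : G, w ∈ {g | w⁻¹ * g ∈ V} := fun w => by simpa using h1
  obtain ⟨t, -, ht⟩ := (isCompact_univ (X := G)).elim_nhds_subcover
    (fun w => {g | w⁻¹ * g ∈ V}) fun w _ => (hop w).mem_nhds (hmem w)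
  obtain ⟨k, -, hk⟩ := exists_forall_supp_inter_nonempty hμ hap
    (U := fun w : t => {g | (w : G)⁻¹ * g ∈ V}) (fun w => hop w) fun w => ⟨w, hmem w⟩
  have hcov : ∀ z : G, ∃ w ∈ t, w⁻¹ * z ∈ V := fun z => by simpa using ht (Set.mem_univ z)
  have hpos : ∀ w ∈ t, 0 < (convPow μ k : Measure G).real {g | w⁻¹ * g ∈ V} := fun w hw => by
    obtain ⟨x, hx, hxV⟩ := hk ⟨w, hw⟩
    exact ENNReal.toReal_pos
      ((Measure.mem_support_iff_forall x).1 hx _ ((hop w).mem_nhds hxV)).ne' (measure_ne_top _ _)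
  obtain ⟨w₀, hw₀, hmin⟩ := t.exists_min_image
    (fun w => (convPow μ k : Measure G).real {g | w⁻¹ * g ∈ V})
    (let ⟨w, hw, _⟩ := hcov 1; ⟨w, hw⟩)
  refine ⟨k, _, hpos w₀ hw₀, fun z => ?_⟩
  obtain ⟨w, hw, hwz⟩ := hcov z⁻¹
  refine (hmin w hw).trans (measureReal_mono fun g hg => ?_)
  simpa [mul_assoc] using hV _ hwz _ hg

/-- The excess of the oscillation over `ε / 2` decays geometrically along multiples of `k`; further
averaging never increases oscillation. -/
theorem exists_forall_average_sub_le {μ : ProbabilityMeasure G} (hμ : IsAdapted μ)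
    (hap : IsStrictlyAperiodic μ) {f : G → ℝ} (hf : Continuous f) {ε : ℝ} (hε : 0 < ε) :
    ∃ n₀, ∀ n ≥ n₀, ∀ x y,
      average (convPow μ n : Measure G) f x - average (convPow μ n : Measure G) f y ≤ ε := by
  obtain ⟨U, hUo, h1, hfU⟩ := exists_nhds_one_forall_le hf (half_pos hε)
  obtain ⟨k, β, hβ, hk⟩ := exists_forall_le_real hμ hap (hUo.mem_nhds h1)
  have hβ1 : β ≤ 1 := (hk 1).trans measureReal_le_one
  obtain ⟨M, -, hM⟩ := isCompact_univ.exists_isMaxOn ⟨(1 : G), Set.mem_univ _⟩ hf.continuousOn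
  obtain ⟨m, -, hm⟩ := isCompact_univ.exists_isMinOn ⟨(1 : G), Set.mem_univ _⟩ hf.continuousOn
  replace hM : ∀ w, f w ≤ f M := fun w => hM (Set.mem_univ w)
  replace hm : ∀ w, f m ≤ f w := fun w => hm (Set.mem_univ w)
  have hC : 0 ≤ f M - f m := sub_nonneg.2 (hm M)
  have key : ∀ j x y, average (convPow μ (j * k) : Measure G) f x -
      average (convPow μ (j * k) : Measure G) f y ≤ ε / 2 + (1 - β) ^ j * (f M - f m) := by
    intro j
    induction j with
    | zero =>
      intro x y
      have := average_sub_average_le (convPow μ (0 * k) : Measure G) hf hUo hC hfU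
        (β := 0) (fun _ => measureReal_nonneg) (fun x y => by linarith [hM x, hm y]) x y
      simpa using this
    | succ j ih =>
      intro x y
      rw [Nat.succ_mul, convPow_add, average_mconv _ _ hf, pow_succ', mul_assoc]
      exact average_sub_average_le _ (continuous_average _ hf) hUo
        (mul_nonneg (pow_nonneg (sub_nonneg.2 hβ1) j) hC)
        (average_le_average_add _ hf hfU) hk ih x y
  have hlim : Tendsto (fun j : ℕ => (1 - β) ^ j * (f M - f m)) atTop (𝓝 0) := by
    simpa using (tendsto_pow_atTop_nhds_zero_of_lt_one (sub_nonneg.2 hβ1)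
      (by linarith : 1 - β < 1)).mul_const (f M - f m)
  obtain ⟨j, hj⟩ := (hlim.eventually_le_const (half_pos hε)).exists
  refine ⟨j * k, fun n hn x y => ?_⟩
  obtain ⟨r, rfl⟩ := Nat.exists_eq_add_of_le hn
  rw [convPow_add, average_mconv _ _ hf]
  -- With `U = ∅`, `β = 0`, `C = 0`, the contraction estimate reduces to monotonicity of the
  -- oscillation.
  simpa using average_sub_average_le (convPow μ r : Measure G) (continuous_average _ hf)
    isOpen_empty le_rfl (δ := ε) (β := 0) (by simp) (fun _ => measureReal_nonneg)
    (fun x y => by linarith [key j x y]) x y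

instance : Measure.IsHaarMeasure (haarProb G : Measure G) :=
  inferInstanceAs (Measure.IsHaarMeasure (Measure.haarMeasure ⊤))

theorem tendsto_convPow_haarProb {μ : ProbabilityMeasure G} (hμ : IsAdapted μ)
    (hap : IsStrictlyAperiodic μ) : Tendsto (convPow μ) atTop (𝓝 (haarProb G)) := by
  refine ProbabilityMeasure.tendsto_iff_forall_integral_tendsto.2 fun f => ?_
  have hf : Continuous f := f.continuous
  refine Metric.tendsto_atTop'.2 fun ε hε => ?_
  obtain ⟨n₀, hn₀⟩ := exists_forall_average_sub_le hμ hap hf (half_pos hε)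
  refine ⟨n₀, fun n hn => ?_⟩
  let F := average (convPow μ n : Measure G) f
  have hF : Integrable F (haarProb G : Measure G) :=
    integrable_of_continuous (continuous_average _ hf) _
  have h1 : ∫ x, f x ∂(convPow μ n : Measure G) = F 1 := by simp [F, average]
  have h2 : ∫ x, F x ∂(haarProb G : Measure G) = ∫ x, f x ∂(haarProb G : Measure G) :=
    integral_average _ _ hf
  have h3 := integral_mono hF (integrable_const (F 1 + ε / 2)) fun x => by
    linarith [hn₀ n hn.le x 1]
  have h4 := integral_mono (integrable_const (F 1 - ε / 2)) hF fun x => by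
    linarith [hn₀ n hn.le 1 x]
  simp only [integral_const, probReal_univ, one_smul] at h3 h4
  rw [h1, ← h2, Real.dist_eq, abs_lt]
  constructor <;> linarith

/-! ### Identification of limits and necessity of strict aperiodicity -/

/-- The maximum principle: a continuous harmonic function of an adapted measure is constant. -/
theorem eq_of_integral_mul_eq {μ : ProbabilityMeasure G} (hμ : IsAdapted μ) {F : G → ℝ}
    (hF : Continuous F) (hharm : ∀ z, ∫ g, F (z * g) ∂(μ : Measure G) = F z) (x y : G) :
    F x = F y := by
  obtain ⟨m, -, hm⟩ := isCompact_univ.exists_isMaxOn ⟨(1 : G), Set.mem_univ _⟩ hF.continuousOn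
  replace hm : ∀ w, F w ≤ F m := fun w => hm (Set.mem_univ w)
  -- Right translations preserving the set of maxima form a closed semigroup. It contains `supp μ`,
  -- since a mean equal to the maximum forces equality on the support.
  let T : Set G := {g | ∀ k, F k = F m → F (k * g) = F m}
  have hT : IsClosed T := by
    have : T = ⋂ k ∈ {k | F k = F m}, {g | F (k * g) = F m} := by ext; simp [T]
    rw [this]
    exact isClosed_biInter fun k _ => isClosed_eq (by fun_prop) continuous_const
  let H := closedSubgroup T hT ⟨1, by simp [T]⟩ fun x hx y hy k hk => by
    rw [← mul_assoc]; exact hy _ (hx k hk)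
  have hsupp : supp μ ⊆ (H : Set G) := by
    intro g hg k hk
    have hcl : IsClosed {g | F (k * g) = F m} := isClosed_eq (by fun_prop) continuous_const
    refine Measure.support_subset_of_isClosed hcl ?_ hg
    have hi : Integrable (fun g => F (k * g)) (μ : Measure G) :=
      integrable_of_continuous (by fun_prop) _
    have h0 : ∫ g, (F m - F (k * g)) ∂(μ : Measure G) = 0 := by
      rw [integral_sub (integrable_const _) hi, hharm, hk]
      simp
    have h1 := (integral_eq_zero_iff_of_nonneg (fun g => sub_nonneg.2 (hm _))
      ((integrable_const _).sub hi)).1 h0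
    filter_upwards [h1] with g hg
    simp only [Pi.zero_apply] at hg
    exact (sub_eq_zero.1 hg).symm
  have hH : H = ⊤ := hμ H hT hsupp
  have hmax : ∀ z, F z = F m := fun z => by
    have hz : m⁻¹ * z ∈ H := hH ▸ Subgroup.mem_top _
    simpa using hz m rfl
  rw [hmax x, hmax y]

theorem eq_haarProb_of_tendsto {μ : ProbabilityMeasure G} (hμ : IsAdapted μ)
    {ν : ProbabilityMeasure G} (hν : Tendsto (convPow μ) atTop (𝓝 ν)) : ν = haarProb G := by
  rw [ProbabilityMeasure.tendsto_iff_forall_integral_tendsto] at hν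
  have hstat : ∀ f : G → ℝ, Continuous f →
      ∫ x, average (μ : Measure G) f x ∂(ν : Measure G) = ∫ x, f x ∂(ν : Measure G) := by
    intro f hf
    have h1 := (hν (BoundedContinuousFunction.mkOfCompact ⟨f, hf⟩)).comp (tendsto_add_atTop_nat 1)
    have h2 := hν (BoundedContinuousFunction.mkOfCompact ⟨_, continuous_average (μ : Measure G) hf⟩)
    refine tendsto_nhds_unique h2 (h1.congr fun n => ?_)
    exact integral_mconv_symm (μ : Measure G) (convPow μ n : Measure G) hf
  have hinv : ∀ f : G → ℝ, Continuous f → ∀ z,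
      ∫ x, f (z * x) ∂(ν : Measure G) = ∫ x, f x ∂(ν : Measure G) := by
    intro f hf z
    have hF : Continuous fun z => ∫ x, f (z * x) ∂(ν : Measure G) := by
      have := continuous_parametric_integral_of_continuous (μ := (ν : Measure G))
        (f := fun z x : G => f (z * x)) (by unfold Function.uncurry; fun_prop) isCompact_univ
      simpa only [Measure.restrict_univ] using! this
    have h := eq_of_integral_mul_eq hμ hF (fun z => ?_) z 1
    · simpa using h
    -- Stationarity of `ν` makes `z ↦ ∫ f (z x) dν` harmonic for `μ`.
    · rw [← hstat (fun x => f (z * x)) (by fun_prop)]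
      simp only [average, mul_assoc]
      exact integral_integral_swap (integrable_of_continuous (by fun_prop) _)
  have hleft : (ν : Measure G).IsMulLeftInvariant := ⟨fun z => by
    have := Measure.isProbabilityMeasure_map (μ := (ν : Measure G))
      (measurable_const_mul z).aemeasurable
    refine ext_of_forall_integral_eq_of_IsFiniteMeasure fun f => ?_
    rw [integral_map (measurable_const_mul z).aemeasurable
      f.continuous.aestronglyMeasurable]
    exact hinv f f.continuous z⟩
  have hhaar : (ν : Measure G).IsHaarMeasure :=
    Measure.isHaarMeasure_of_isCompact_nonempty_interior (ν : Measure G) Set.univ isCompact_univ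
      (by simp) (by simp) (by simp)
  exact Subtype.ext (Measure.isHaarMeasure_eq_of_isProbabilityMeasure
    (ν : Measure G) (haarProb G : Measure G))

/-- If `c` is a cluster point of `g ^ n` and `y ∉ N`, some neighbourhood of `c y` misses `g ^ n N`
whenever `g ^ n` is near `c`. It is null for infinitely many powers, against the portmanteau bound.
-/
theorem isStrictlyAperiodic_of_tendsto {μ : ProbabilityMeasure G}
    (h : Tendsto (convPow μ) atTop (𝓝 (haarProb G))) : IsStrictlyAperiodic μ := by
  intro N hNn hNc hN g hg
  obtain ⟨c, hc⟩ : ∃ c, MapClusterPt c atTop (g ^ · : ℕ → G) :=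
    exists_clusterPt_of_compactSpace _
  refine hN ((Subgroup.eq_top_iff' N).2 fun y => ?_)
  by_contra hy
  have hcl : IsOpen {p : G × G | p.1⁻¹ * p.2 ∉ N} :=
    (hNc.preimage (by fun_prop : Continuous fun p : G × G => p.1⁻¹ * p.2)).isOpen_compl
  have hmem : {p : G × G | p.1⁻¹ * p.2 ∉ N} ∈ 𝓝 (c, c * y) :=
    hcl.mem_nhds (by simpa using hy)
  obtain ⟨V, U, hVo, hcV, hUo, hyU, hVU⟩ := mem_nhds_prod_iff'.1 hmem
  have hzero : ∃ᶠ n in atTop, (convPow μ n : Measure G) U ≤ 0 := by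
    refine (mapClusterPt_iff_frequently.1 hc V (hVo.mem_nhds hcV)).mono fun n hn => ?_
    refine le_of_eq (measure_mono_null ?_ (ae_mem_coset hNn hNc hg n))
    exact fun x hx => hVU (Set.mk_mem_prod hn hx)
  have hle := ProbabilityMeasure.le_liminf_measure_open_of_tendsto h hUo
  have h0 : atTop.liminf (fun n => (convPow μ n : Measure G) U) ≤ 0 :=
    liminf_le_of_frequently_le hzero
  exact (hUo.measure_pos (haarProb G : Measure G) ⟨_, hyU⟩).not_ge (hle.trans h0)

/-! ### Dense supports and deterministic images -/

theorem exists_isEpsDense {μ : ProbabilityMeasure G} (hμ : IsAdapted μ)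
    (hap : IsStrictlyAperiodic μ) {d : MetricSpace G} (hd : IsBiinvariant d) {ε : ℝ}
    (hε : 0 < ε) : ∃ n, 1 ≤ n ∧ IsEpsDense d ε (supp (convPow μ n)) := by
  have hop : ∀ x (r : ℝ), IsOpen {y | d.dist y x < r} := fun x r => by
    rw [← hd.topology_eq]
    exact @Metric.isOpen_ball G d.toPseudoMetricSpace x r
  have hself : ∀ x, x ∈ {y | d.dist y x < ε / 2} := fun x => by
    simpa [d.dist_self] using hε
  obtain ⟨t, -, ht⟩ := (isCompact_univ (X := G)).elim_nhds_subcover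
    (fun x => {y | d.dist y x < ε / 2}) fun x _ => (hop x _).mem_nhds (hself x)
  obtain ⟨n, hn1, hn⟩ := exists_forall_supp_inter_nonempty hμ hap
    (U := fun x : t => {y | d.dist y x < ε / 2}) (fun x => hop x _) fun x => ⟨x, hself x⟩
  refine ⟨n, hn1, fun x => ?_⟩
  obtain ⟨z, hz, hxz⟩ : ∃ z ∈ t, d.dist x z < ε / 2 := by simpa using ht (Set.mem_univ x)
  obtain ⟨y, hy, hyz⟩ := hn ⟨z, hz⟩
  refine ⟨y, hy, ?_⟩
  have h1 : d.dist y z < ε / 2 := hyz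
  rw [d.dist_comm] at h1
  linarith [d.dist_triangle x z y]

end Convolution

/-- Let `x` and `y` be centres of balls in `A` and `Bᶜ`. By right invariance, a support element `g`
within `ε` of `y x⁻¹` moves `x` into the ball around `y`, although `g x ∈ B`. -/
theorem IsEpsDense.noDeterministicEpsImages {G : Type*} [Group G] [TopologicalSpace G]
    [MeasurableSpace G] {d : MetricSpace G} (hd : IsBiinvariant d) {ε : ℝ}
    {μ : ProbabilityMeasure G} (h : IsEpsDense d ε (supp μ)) : NoDeterministicEpsImages d ε μ := by
  rintro ⟨A, B, -, -, ⟨x, hx⟩, -, -, ⟨y, hy⟩, hAB⟩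
  obtain ⟨g, hg, hyg⟩ := h (y * x⁻¹)
  have hε : 0 < ε := by
    refine lt_of_le_of_lt ?_ hyg
    exact @dist_nonneg G d.toPseudoMetricSpace _ _
  have hxA : x ∈ A := hx (by simpa [d.dist_self] using hε)
  have hgB : g * x ∈ B := hAB g hg ▸ ⟨x, hxA, rfl⟩
  refine hy ?_ hgB
  have := hd.right_inv x (y * x⁻¹) g
  rw [inv_mul_cancel_right, d.dist_comm] at this
  exact this.trans_lt hyg

end RandomWalk

theorem mainTheorem6 {G : Type*} [Group G] [TopologicalSpace G] [IsTopologicalGroup G]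
    [CompactSpace G] [T2Space G] [SecondCountableTopology G] [MeasurableSpace G] [BorelSpace G]
    (μ : ProbabilityMeasure G) (hμ : RandomWalk.IsAdapted μ) :
    -- convergence to Haar measure under strict aperiodicity
    (RandomWalk.IsStrictlyAperiodic μ →
      Tendsto (RandomWalk.convPow μ) atTop (𝓝 (RandomWalk.haarProb G))) ∧
    -- the limit exists if and only if `μ` is strictly aperiodic
    ((∃ ν : ProbabilityMeasure G, Tendsto (RandomWalk.convPow μ) atTop (𝓝 ν)) ↔
      RandomWalk.IsStrictlyAperiodic μ) ∧
    -- if the limit exists, it is the Haar measure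
    (∀ ν : ProbabilityMeasure G, Tendsto (RandomWalk.convPow μ) atTop (𝓝 ν) →
      ν = RandomWalk.haarProb G) ∧
    -- density of the supports, and the absence of deterministic images, at every scale
    (RandomWalk.IsStrictlyAperiodic μ →
      ∀ d : MetricSpace G, RandomWalk.IsBiinvariant d → ∀ ε : ℝ, 0 < ε →
        (∃ n : ℕ, 1 ≤ n ∧ RandomWalk.IsEpsDense d ε (RandomWalk.supp (RandomWalk.convPow μ n))) ∧
        (∃ n : ℕ, 1 ≤ n ∧
          RandomWalk.NoDeterministicEpsImages d ε (RandomWalk.convPow μ n))) := by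
  refine ⟨RandomWalk.tendsto_convPow_haarProb hμ, ⟨?_, fun h => ⟨_,
    RandomWalk.tendsto_convPow_haarProb hμ h⟩⟩,
    fun ν hν => RandomWalk.eq_haarProb_of_tendsto hμ hν, fun hap d hd ε hε => ?_⟩
  · rintro ⟨ν, hν⟩
    obtain rfl := RandomWalk.eq_haarProb_of_tendsto hμ hν
    exact RandomWalk.isStrictlyAperiodic_of_tendsto hν
  · obtain ⟨n, hn, hdense⟩ := RandomWalk.exists_isEpsDense hμ hap hd hε
    exact ⟨⟨n, hn, hdense⟩, n, hn, hdense.noDeterministicEpsImages hd⟩
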